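/- Put $\coth x=\cosh x/\sinh x$ for real $x\neq 0$, let $\zeta$ be the Riemann zeta function, and let $B_n$ be the Bernoulli numbers, $\frac{t}{e^t-1}=\sum_{n\ge 0}B_n\frac{t^n}{n!}$. Let $k>1$ be an integer and let $\alpha,\beta$ be real numbers (of either sign) with $\alpha\beta=\pi^2$. Then all infinite series below converge, and the following hold. (1) (Reciprocity) $$\alpha\beta^k\sum_{n=1}^\infty\frac{\coth(n\alpha)}{n^{2k-1}}+(-1)^k\alpha^k\beta\sum_{n=1}^\infty\frac{\coth(n\beta)}{n^{2k-1}} =\bigl(\beta^k+(-1)^k\alpha^k\bigr)\zeta(2k)-2\sum_{\substack{k_1+k_2=k\\ k_1,k_2\ge 1}}(-1)^{k_2}\alpha^{k_2}\beta^{k_1}\zeta(2k_1)\zeta(2k_2).$$ (2) For every real $x\ne 0$, $\displaystyle \coth x=1+\frac{2}{e^{2x}-1}$. (3) (Ramanujan's formula for $\zeta(2k-1)$) $$(4\beta)^{-(k-1)}\left\{\frac12\zeta(2k-1)+\sum_{n=1}^\infty\frac{1}{n^{2k-1}(e^{2n\beta}-1)}\right\}-(-4\alpha)^{-(k-1)}\left\{\frac12\zeta(2k-1)+\sum_{n=1}^\infty\frac{1}{n^{2k-1}(e^{2n\alpha}-1)}\right\}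 =\sum_{j=0}^k(-1)^{j-1}\frac{B_{2j}B_{2k-2j}}{(2j)!\,(2k-2j)!}\alpha^j\beta^{k-j}.$$ -/

import Mathlib

/-- The hyperbolic cotangent of a real number, `cosh x / sinh x` (meaningful for `x ≠ 0`). -/
noncomputable def coth (x : ℝ) : ℝ := Real.cosh x / Real.sinh x

/-- The terms of the series `∑ coth (n a) / n ^ (2 k - 1)`, `n = 1, 2, …`;
the index `n : ℕ` of the code stands for the summation index `n + 1`. -/
noncomputable def cothTerm (k : ℕ) (a : ℝ) (n : ℕ) : ℝ :=
  coth (((n : ℝ) + 1) * a) / ((n : ℝ) + 1) ^ (2 * k - 1)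

/-- The terms of the series `∑ 1 / (n ^ (2 k - 1) (exp (2 n a) - 1))`, `n = 1, 2, …`;
the index `n : ℕ` of the code stands for the summation index `n + 1`. -/
noncomputable def expTerm (k : ℕ) (a : ℝ) (n : ℕ) : ℝ :=
  1 / (((n : ℝ) + 1) ^ (2 * k - 1) * (Real.exp (2 * ((n : ℝ) + 1) * a) - 1))

/-! Expand each coth(nα) in partial fractions. As αβ = π², the denominator (nα)² + π²m² equals α(n²α
+ m²β), so the coth series is ζ(2k)/α plus twice the double series of 1/(n^(2k-2)(n²α + m²β))
(`hasSum_cothTerm`). Exchanging α and β exchanges n and m, and in the combination of the theorem the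
common denominator divides out by a geometric sum (`latticeTerm_add_latticeTerm_swap`). What remains
is a finite sum of products n^(-2k₁) m^(-2k₂), whose sums are ζ(2k₁)ζ(2k₂). Ramanujan's formula is
the same identity: coth x = 1 + 2/(e^(2x) - 1) brings in ζ(2k-1), and Euler's formula the Bernoulli
numbers. -/

/-- The value `ζ (2 j)` as a real number, by Euler's formula. -/
noncomputable def evenZeta (j : ℕ) : ℝ :=
  (-1) ^ (j + 1) * 2 ^ (2 * j - 1 : ℤ) * Real.pi ^ (2 * j) * bernoulli (2 * j) /
    (2 * j).factorial

theorem riemannZeta_two_mul_eq_evenZeta (j : ℕ) : riemannZeta (2 * (j : ℂ)) = evenZeta j := by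
  rw [riemannZeta_two_mul_nat', evenZeta]
  push_cast
  rfl

/-- The exponent 2j - 1 is an integer, so j = 0 gives a factor 1/2 and the true value of ζ(0). -/
theorem evenZeta_zero : evenZeta 0 = -1 / 2 := by
  simp [evenZeta]
  norm_num

theorem hasSum_evenZeta {j : ℕ} (hj : j ≠ 0) :
    HasSum (fun n : ℕ => 1 / ((n : ℝ) + 1) ^ (2 * j)) (evenZeta j) := by
  have h := hasSum_zeta_nat hj
  rw [← hasSum_nat_add_iff' 1] at h
  convert! h using 1
  · simp
  · have : (2 : ℝ) ^ (2 * (j : ℤ) - 1) = 2 ^ (2 * j - 1) := by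
      rw [← zpow_natCast]
      congr 1
      lia
    simp [evenZeta, this, hj]

/-! ### The hyperbolic cotangent -/

/-- The partial fraction expansion of the hyperbolic cotangent. -/
theorem hasSum_coth {x : ℝ} (hx : x ≠ 0) :
    HasSum (fun m : ℕ => 2 * x / (x ^ 2 + Real.pi ^ 2 * ((m : ℝ) + 1) ^ 2)) (coth x - 1 / x) := by
  have hpi : (Real.pi : ℂ) ≠ 0 := by exact_mod_cast Real.pi_ne_zero
  have hxC : (x : ℂ) ≠ 0 := by exact_mod_cast hx
  -- At z = ix/π the series for π cot(πz) gives coth after multiplication by i/π, since i cot(ix) =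
  -- coth x.
  set z : ℂ := (x : ℂ) / Real.pi * Complex.I with hz
  have hzc : z ∈ Complex.integerComplement := by
    rintro ⟨m, hm⟩
    have him : z.im = x / Real.pi := by
      rw [hz, ← Complex.ofReal_div, Complex.im_ofReal_mul, Complex.I_im, mul_one]
    rw [← hm] at him
    simp [hx, Real.pi_ne_zero, eq_comm] at him
  have h := ((summable_cotTerm hzc).hasSum.mul_left (Complex.I / Real.pi))
  have hs : (∑' n : ℕ, cotTerm z n) = Real.pi * Complex.cot (Real.pi * z) - 1 / z :=
    (cot_series_rep' hzc).symm
  rw [hs] at h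
  rw [← Complex.hasSum_ofReal]
  have hsinh : Complex.sinh x ≠ 0 := by
    rw [← Complex.ofReal_sinh]
    exact_mod_cast Real.sinh_ne_zero.mpr hx
  convert! h using 1
  · funext m
    have hden : (x : ℂ) ^ 2 + Real.pi ^ 2 * ((m : ℂ) + 1) ^ 2 ≠ 0 := by
      have : x ^ 2 + Real.pi ^ 2 * ((m : ℝ) + 1) ^ 2 ≠ 0 := by positivity
      exact_mod_cast this
    have h2 : z ^ 2 - ((m : ℂ) + 1) ^ 2 =
        -((x : ℂ) ^ 2 + Real.pi ^ 2 * ((m : ℂ) + 1) ^ 2) / Real.pi ^ 2 := by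
      rw [hz, mul_pow, Complex.I_sq]
      field_simp
      ring
    have h3 : z ^ 2 - ((m : ℂ) + 1) ^ 2 ≠ 0 := by
      rw [h2]
      exact div_ne_zero (neg_ne_zero.mpr hden) (pow_ne_zero 2 hpi)
    have h4 : z - ((m : ℂ) + 1) ≠ 0 := fun h0 => h3 (by linear_combination (z + (m + 1)) * h0)
    have h5 : z + ((m : ℂ) + 1) ≠ 0 := fun h0 => h3 (by linear_combination (z - (m + 1)) * h0)
    have h6 : cotTerm z m = 2 * z / (z ^ 2 - ((m : ℂ) + 1) ^ 2) := by
      rw [cotTerm]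
      rw [div_add_div _ _ h4 h5, div_eq_div_iff (mul_ne_zero h4 h5) h3]
      ring
    rw [h6, h2, hz]
    push_cast
    field_simp
    rw [Complex.I_sq]
    ring
  · have h1 : (Real.pi : ℂ) * z = x * Complex.I := by
      rw [hz]
      field_simp
    rw [h1, Complex.cot, Complex.cos_mul_I, Complex.sin_mul_I, coth, hz]
    push_cast
    field_simp

theorem coth_eq_one_add {x : ℝ} (hx : x ≠ 0) : coth x = 1 + 2 / (Real.exp (2 * x) - 1) := by
  have h1 : Real.exp (2 * x) - 1 ≠ 0 := by
    rw [sub_ne_zero, Ne, Real.exp_eq_one_iff]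
    simpa using hx
  have h2 : Real.exp (2 * x) = Real.exp x ^ 2 := by rw [← Real.exp_nat_mul]; norm_num
  have h3 := Real.exp_ne_zero x
  rw [h2] at h1 ⊢
  have h4 : Real.exp x - (Real.exp x)⁻¹ ≠ 0 := by
    intro h
    apply h1
    field_simp at h
    linear_combination h
  rw [coth, Real.cosh_eq, Real.sinh_eq, Real.exp_neg]
  field_simp
  ring

/-! ### The double series and reciprocity -/

/-- The double series behind the reciprocity of the `coth` series. -/
noncomputable def latticeTerm (l : ℕ) (a b : ℝ) (p : ℕ × ℕ) : ℝ :=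
  1 / (((p.1 : ℝ) + 1) ^ (2 * (l + 1)) *
    (((p.1 : ℝ) + 1) ^ 2 * a + ((p.2 : ℝ) + 1) ^ 2 * b))

theorem abs_add_of_mul_pos {a b : ℝ} (h : 0 < a * b) : |a + b| = |a| + |b| := by
  rw [abs_add_eq_add_abs_iff]
  rcases mul_pos_iff.mp h with h | h
  · exact Or.inl ⟨h.1.le, h.2.le⟩
  · exact Or.inr ⟨h.1.le, h.2.le⟩

theorem sq_mul_add_sq_mul_ne_zero {a b : ℝ} (h : 0 < a * b) (n m : ℕ) :
    ((n : ℝ) + 1) ^ 2 * a + ((m : ℝ) + 1) ^ 2 * b ≠ 0 := by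
  rcases mul_pos_iff.mp h with ⟨ha, hb⟩ | ⟨ha, hb⟩
  · positivity
  · have : 0 < ((n : ℝ) + 1) ^ 2 * (-a) + ((m : ℝ) + 1) ^ 2 * (-b) := by
      have := neg_pos.mpr ha
      have := neg_pos.mpr hb
      positivity
    intro h0
    linarith

/-- As a and b have the same sign, |n²a + m²b| ≥ m²|b|, and a product of two convergent series
dominates. -/
theorem summable_latticeTerm (l : ℕ) {a b : ℝ} (h : 0 < a * b) :
    Summable (latticeTerm l a b) := by
  have hb : 0 < |b| := abs_pos.mpr (right_ne_zero_of_mul h.ne')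
  have hp := ((hasSum_evenZeta (Nat.succ_ne_zero l)).summable.mul_of_nonneg
    (hasSum_evenZeta one_ne_zero).summable (fun n => by positivity) (fun n => by positivity)).mul_left
      |b|⁻¹
  refine Summable.of_norm_bounded hp fun p => ?_
  have hs : 0 < (((p.1 : ℝ) + 1) ^ 2 * a) * (((p.2 : ℝ) + 1) ^ 2 * b) := by
    have : (((p.1 : ℝ) + 1) ^ 2 * a) * (((p.2 : ℝ) + 1) ^ 2 * b) =
      (((p.1 : ℝ) + 1) ^ 2 * ((p.2 : ℝ) + 1) ^ 2) * (a * b) := by ring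
    rw [this]
    positivity
  have hle : ((p.2 : ℝ) + 1) ^ 2 * |b| ≤
      |((p.1 : ℝ) + 1) ^ 2 * a + ((p.2 : ℝ) + 1) ^ 2 * b| := by
    rw [abs_add_of_mul_pos hs, abs_mul (((p.2 : ℝ) + 1) ^ 2) b,
      abs_of_nonneg (by positivity : 0 ≤ ((p.2 : ℝ) + 1) ^ 2)]
    linarith [abs_nonneg (((p.1 : ℝ) + 1) ^ 2 * a)]
  rw [latticeTerm, Real.norm_eq_abs, abs_div, abs_one, abs_mul,
    abs_of_nonneg (by positivity : 0 ≤ ((p.1 : ℝ) + 1) ^ (2 * (l + 1)))]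
  calc _ ≤ 1 / (((p.1 : ℝ) + 1) ^ (2 * (l + 1)) * (((p.2 : ℝ) + 1) ^ 2 * |b|)) := by gcongr
    _ = _ := by
      simp only [Nat.succ_eq_add_one, mul_one]
      field_simp

theorem hasSum_cothTerm (l : ℕ) {a b : ℝ} (h : a * b = Real.pi ^ 2) :
    HasSum (cothTerm (l + 2) a)
      (evenZeta (l + 2) / a + 2 * ∑' p, latticeTerm l a b p) := by
  have hpos : 0 < a * b := h ▸ pow_pos Real.pi_pos 2
  have ha : a ≠ 0 := left_ne_zero_of_mul hpos.ne'
  have h1 := (hasSum_evenZeta (Nat.succ_ne_zero (l + 1))).div_const a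
  have h2 := ((summable_latticeTerm l hpos).hasSum.mul_left 2).prod_fiberwise
    (g := fun n : ℕ => (coth (((n : ℝ) + 1) * a) - 1 / (((n : ℝ) + 1) * a)) /
      ((n : ℝ) + 1) ^ (2 * l + 3)) fun n => by
    have hn : ((n : ℝ) + 1) * a ≠ 0 := mul_ne_zero (by positivity) ha
    convert! (hasSum_coth hn).div_const (((n : ℝ) + 1) ^ (2 * l + 3)) using 1
    funext m
    have hd := sq_mul_add_sq_mul_ne_zero hpos n m
    have he : (((n : ℝ) + 1) * a) ^ 2 + Real.pi ^ 2 * ((m : ℝ) + 1) ^ 2 =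
      a * (((n : ℝ) + 1) ^ 2 * a + ((m : ℝ) + 1) ^ 2 * b) := by rw [← h]; ring
    rw [he, latticeTerm]
    field_simp
    ring
  convert! h1.add h2 using 1
  funext n
  have hn : (n : ℝ) + 1 ≠ 0 := by positivity
  rw [cothTerm, show 2 * (l + 2) - 1 = 2 * l + 3 by lia]
  simp only [Nat.succ_eq_add_one]
  field_simp
  ring

/-- Partial fractions: the combination of the two double series splits into products. -/
theorem latticeTerm_add_latticeTerm_swap (l : ℕ) {a b : ℝ} (h : 0 < a * b) (p : ℕ × ℕ) :
    a * b ^ (l + 2) * latticeTerm l a b p +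
        (-1) ^ l * a ^ (l + 2) * b * latticeTerm l b a p.swap =
      ∑ i ∈ Finset.range (l + 1), -((-1) ^ (l - i + 1) * a ^ (l - i + 1) * b ^ (i + 1)) *
        (1 / ((p.1 : ℝ) + 1) ^ (2 * (i + 1)) * (1 / ((p.2 : ℝ) + 1) ^ (2 * (l - i + 1)))) := by
  obtain ⟨n, m⟩ := p
  have hd := sq_mul_add_sq_mul_ne_zero h n m
  -- The difference of these two bases is the common denominator n²a + m²b.
  have hg := geom_sum₂_mul (((m : ℝ) + 1) ^ 2 * b) (-(((n : ℝ) + 1) ^ 2 * a)) (l + 1)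
  simp only [latticeTerm, Prod.swap]
  have hn : (n : ℝ) + 1 ≠ 0 := by positivity
  have hm : (m : ℝ) + 1 ≠ 0 := by positivity
  generalize (n : ℝ) + 1 = x at *
  generalize (m : ℝ) + 1 = y at *
  rw [add_comm (y ^ 2 * b)]
  have key : ∀ i ∈ Finset.range (l + 1),
      -((-1) ^ (l - i + 1) * a ^ (l - i + 1) * b ^ (i + 1)) *
        (1 / x ^ (2 * (i + 1)) * (1 / y ^ (2 * (l - i + 1)))) =
      a * b / (x ^ (2 * (l + 1)) * y ^ (2 * (l + 1))) *
        ((y ^ 2 * b) ^ i * (-(x ^ 2 * a)) ^ (l + 1 - 1 - i)) := by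
    intro i hi
    obtain ⟨j, rfl⟩ := Nat.exists_eq_add_of_le (Nat.lt_succ_iff.mp (Finset.mem_range.mp hi))
    have e1 : i + j - i = j := by lia
    have e2 : i + j + 1 - 1 - i = j := by lia
    rw [e1, e2, neg_pow (x ^ 2 * a)]
    field_simp
    ring
  rw [Finset.sum_congr rfl key, ← Finset.mul_sum]
  refine mul_right_cancel₀ hd ?_
  have hg' : (∑ i ∈ Finset.range (l + 1),
      (y ^ 2 * b) ^ i * (-(x ^ 2 * a)) ^ (l + 1 - 1 - i)) * (x ^ 2 * a + y ^ 2 * b) =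
        (y ^ 2 * b) ^ (l + 1) - (-(x ^ 2 * a)) ^ (l + 1) := by
    rw [← hg]; ring
  rw [mul_assoc (a * b / _), hg', neg_pow (x ^ 2 * a)]
  clear hg hg' key
  generalize x ^ 2 * a + y ^ 2 * b = d at *
  field_simp
  ring

theorem sum_filter_antidiagonal_one_le {M : Type*} [AddCommMonoid M] (l : ℕ) (f : ℕ × ℕ → M) :
    ∑ p ∈ (Finset.HasAntidiagonal.antidiagonal (l + 2)).filter (fun p => 1 ≤ p.1 ∧ 1 ≤ p.2), f p =
      ∑ i ∈ Finset.range (l + 1), f (i + 1, l - i + 1) := by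
  rw [Finset.sum_filter, Finset.Nat.sum_antidiagonal_eq_sum_range_succ_mk, Finset.sum_range_succ,
    Finset.sum_range_succ']
  simp only [Nat.sub_self, Nat.le_zero, one_ne_zero, and_false, if_false, add_zero, false_and]
  refine Finset.sum_congr rfl fun i hi => ?_
  rw [Finset.mem_range] at hi
  rw [if_pos ⟨by lia, by lia⟩, show l + 2 - (i + 1) = l - i + 1 by lia]

theorem coth_reciprocity (l : ℕ) {a b : ℝ} (h : a * b = Real.pi ^ 2) :
    a * b ^ (l + 2) * ∑' n, cothTerm (l + 2) a n +
        (-1) ^ l * a ^ (l + 2) * b * ∑' n, cothTerm (l + 2) b n =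
      (b ^ (l + 2) + (-1) ^ l * a ^ (l + 2)) * evenZeta (l + 2) -
        2 * ∑ i ∈ Finset.range (l + 1), (-1) ^ (l - i + 1) * a ^ (l - i + 1) * b ^ (i + 1) *
          evenZeta (i + 1) * evenZeta (l - i + 1) := by
  have hpos : 0 < a * b := h ▸ pow_pos Real.pi_pos 2
  have hpos' : 0 < b * a := mul_comm a b ▸ hpos
  have ha : a ≠ 0 := left_ne_zero_of_mul hpos.ne'
  have hb : b ≠ 0 := right_ne_zero_of_mul hpos.ne'
  -- The second double series is reindexed by the swap, so that the two can be added term by term.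
  have h1 := ((summable_latticeTerm l hpos).hasSum.mul_left (a * b ^ (l + 2))).add
    (((Equiv.prodComm ℕ ℕ).hasSum_iff.mpr (summable_latticeTerm l hpos').hasSum).mul_left
      ((-1) ^ l * a ^ (l + 2) * b))
  have h2 : HasSum (fun p : ℕ × ℕ => ∑ i ∈ Finset.range (l + 1),
      -((-1) ^ (l - i + 1) * a ^ (l - i + 1) * b ^ (i + 1)) *
        (1 / ((p.1 : ℝ) + 1) ^ (2 * (i + 1)) * (1 / ((p.2 : ℝ) + 1) ^ (2 * (l - i + 1)))))
      (∑ i ∈ Finset.range (l + 1), -((-1) ^ (l - i + 1) * a ^ (l - i + 1) * b ^ (i + 1)) *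
        (evenZeta (i + 1) * evenZeta (l - i + 1))) := by
    refine hasSum_sum fun i _ => HasSum.mul_left _ ?_
    have s1 := hasSum_evenZeta (j := i + 1) (by simp)
    have s2 := hasSum_evenZeta (j := l - i + 1) (by simp)
    have s3 := s1.summable.mul_of_nonneg s2.summable
      (fun n => by positivity) (fun n => by positivity)
    exact s1.mul s2 s3
  simp only [Function.comp_apply, Equiv.prodComm_apply,
    latticeTerm_add_latticeTerm_swap l hpos] at h1
  have h3 := h1.unique h2
  rw [(hasSum_cothTerm l h).tsum_eq, (hasSum_cothTerm l (mul_comm a b ▸ h)).tsum_eq]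
  have h4 : ∑ i ∈ Finset.range (l + 1), -((-1) ^ (l - i + 1) * a ^ (l - i + 1) * b ^ (i + 1)) *
        (evenZeta (i + 1) * evenZeta (l - i + 1)) =
      -∑ i ∈ Finset.range (l + 1), (-1) ^ (l - i + 1) * a ^ (l - i + 1) * b ^ (i + 1) *
          evenZeta (i + 1) * evenZeta (l - i + 1) := by
    rw [← Finset.sum_neg_distrib]
    exact Finset.sum_congr rfl fun i _ => by ring
  rw [h4] at h3
  field_simp
  field_simp at h3
  linear_combination 2 * h3

/-- Since ζ(0) = -1/2, the isolated ζ(2k) terms are the end terms j = 0 and j = k of the full sum.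
-/
theorem coth_reciprocity_bernoulli (l : ℕ) {a b : ℝ} (h : a * b = Real.pi ^ 2) :
    a * b ^ (l + 2) * ∑' n, cothTerm (l + 2) a n +
        (-1) ^ l * a ^ (l + 2) * b * ∑' n, cothTerm (l + 2) b n =
      -2 * ∑ j ∈ Finset.range (l + 3),
        (-1) ^ j * a ^ j * b ^ (l + 2 - j) * evenZeta (l + 2 - j) * evenZeta j := by
  -- Here j plays the role of k₂, while the sum in `coth_reciprocity` runs over i = k₁ - 1.
  rw [coth_reciprocity l h, ← Finset.sum_range_reflect _ (l + 3),
    Finset.sum_range_succ _ (l + 2), Finset.sum_range_succ' _ (l + 1)]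
  have h1 : ∀ i ∈ Finset.range (l + 1),
      (-1) ^ (l + 3 - 1 - (i + 1)) * a ^ (l + 3 - 1 - (i + 1)) *
        b ^ (l + 2 - (l + 3 - 1 - (i + 1))) * evenZeta (l + 2 - (l + 3 - 1 - (i + 1))) *
        evenZeta (l + 3 - 1 - (i + 1)) =
      (-1) ^ (l - i + 1) * a ^ (l - i + 1) * b ^ (i + 1) *
        evenZeta (i + 1) * evenZeta (l - i + 1) := by
    intro i hi
    rw [Finset.mem_range] at hi
    rw [show l + 3 - 1 - (i + 1) = l - i + 1 by lia, show l + 2 - (l - i + 1) = i + 1 by lia]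
  rw [Finset.sum_congr rfl h1]
  simp only [show l + 3 - 1 - 0 = l + 2 by lia, show l + 3 - 1 - (l + 2) = 0 by lia, Nat.sub_self,
    Nat.sub_zero, evenZeta_zero]
  ring

/-! ### Bernoulli numbers and Ramanujan's formula -/

theorem evenZeta_mul_evenZeta {k j : ℕ} (hj : j ≤ k) :
    evenZeta (k - j) * evenZeta j = (-1) ^ k * 4 ^ k / 4 * Real.pi ^ (2 * k) *
      (bernoulli (2 * j) * bernoulli (2 * k - 2 * j) /
        ((2 * j).factorial * (2 * k - 2 * j).factorial)) := by
  obtain ⟨i, rfl⟩ := Nat.exists_eq_add_of_le hj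
  rw [show 2 * (j + i) - 2 * j = 2 * i by lia, show j + i - j = i by lia, evenZeta, evenZeta]
  have h2 : ∀ m : ℕ, (2 : ℝ) ^ (2 * (m : ℤ) - 1) = 4 ^ m / 2 := fun m => by
    rw [zpow_sub₀ two_ne_zero, zpow_mul]
    norm_num
  rw [h2, h2]
  field_simp
  ring_nf

theorem hasSum_expTerm (l : ℕ) {a b : ℝ} (h : a * b = Real.pi ^ 2) :
    HasSum (expTerm (l + 2) a) ((∑' n, cothTerm (l + 2) a n -
      ∑' n : ℕ, 1 / ((n : ℝ) + 1) ^ (2 * l + 3)) / 2) := by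
  have ha : a ≠ 0 := by
    rintro rfl
    simp [Real.pi_ne_zero, eq_comm] at h
  have hz : Summable fun n : ℕ => 1 / ((n : ℝ) + 1) ^ (2 * l + 3) := by
    have := (summable_nat_add_iff 1).mpr
      (Real.summable_one_div_nat_pow.mpr (by lia : 1 < 2 * l + 3))
    simpa using this
  convert! ((hasSum_cothTerm l h).summable.hasSum.sub hz.hasSum).div_const 2 using 1
  funext n
  have hn : ((n : ℝ) + 1) * a ≠ 0 := mul_ne_zero (by positivity) ha
  have he : Real.exp (2 * (((n : ℝ) + 1) * a)) - 1 ≠ 0 := by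
    rw [sub_ne_zero, Ne, Real.exp_eq_one_iff]
    simpa using hn
  rw [expTerm, cothTerm, coth_eq_one_add hn, show 2 * (l + 2) - 1 = 2 * l + 3 by lia,
    mul_assoc 2 _ a]
  field_simp
  ring

theorem riemannZeta_odd (l : ℕ) :
    riemannZeta (2 * ((l + 2 : ℕ) : ℂ) - 1) =
      ((∑' n : ℕ, 1 / ((n : ℝ) + 1) ^ (2 * l + 3) : ℝ) : ℂ) := by
  rw [show 2 * ((l + 2 : ℕ) : ℂ) - 1 = ((2 * l + 3 : ℕ) : ℂ) by push_cast; ring,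
    zeta_eq_tsum_one_div_nat_add_one_cpow (by norm_cast; lia)]
  push_cast
  refine tsum_congr fun n => ?_
  norm_cast

/-- By `hasSum_expTerm`, half of each coth series is the corresponding brace in Ramanujan's formula.
-/
theorem ramanujan_formula (l : ℕ) {a b : ℝ} (h : a * b = Real.pi ^ 2) :
    ((4 * b) ^ (l + 1))⁻¹ * ((∑' n, cothTerm (l + 2) b n) / 2) -
        ((-4 * a) ^ (l + 1))⁻¹ * ((∑' n, cothTerm (l + 2) a n) / 2) =
      ∑ j ∈ Finset.range (l + 3), (-1) ^ ((j : ℤ) - 1) *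
        (bernoulli (2 * j) * bernoulli (2 * (l + 2) - 2 * j) /
          ((2 * j).factorial * (2 * (l + 2) - 2 * j).factorial)) * a ^ j * b ^ (l + 2 - j) := by
  have hne : a * b ≠ 0 := h ▸ pow_ne_zero 2 Real.pi_ne_zero
  have ha : a ≠ 0 := left_ne_zero_of_mul hne
  have hb : b ≠ 0 := right_ne_zero_of_mul hne
  have hr := coth_reciprocity_bernoulli l h
  have hsum : ∑ j ∈ Finset.range (l + 3),
        (-1) ^ j * a ^ j * b ^ (l + 2 - j) * evenZeta (l + 2 - j) * evenZeta j =
      -((-1) ^ (l + 2) * 4 ^ (l + 2) / 4 * (a * b) ^ (l + 2)) *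
        ∑ j ∈ Finset.range (l + 3), (-1) ^ ((j : ℤ) - 1) *
        (bernoulli (2 * j) * bernoulli (2 * (l + 2) - 2 * j) /
          ((2 * j).factorial * (2 * (l + 2) - 2 * j).factorial)) * a ^ j * b ^ (l + 2 - j) := by
    rw [Finset.mul_sum]
    refine Finset.sum_congr rfl fun j hj => ?_
    have hj' : j ≤ l + 2 := Nat.lt_succ_iff.mp (Finset.mem_range.mp hj)
    rw [mul_assoc _ (evenZeta _), evenZeta_mul_evenZeta hj', h, ← pow_mul,
      zpow_sub₀ (by norm_num), zpow_natCast]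
    ring
  rw [hsum] at hr
  generalize ∑ j ∈ Finset.range (l + 3), (_ : ℝ) = R at hr ⊢
  have hs : ((-1 : ℝ) ^ l) * (-1) ^ l = 1 := by rw [← mul_pow]; norm_num
  have hinv : ((-4 * a) ^ (l + 1))⁻¹ = -(-1) ^ l * ((4 * a) ^ (l + 1))⁻¹ := by
    rw [neg_mul, neg_pow, mul_inv, ← inv_pow]
    norm_num [pow_succ]
  rw [hinv]
  have he : (-1 : ℝ) ^ (l + 2) = (-1) ^ l := by ring
  rw [he] at hr
  generalize (-1 : ℝ) ^ l = e at *
  have hd : 2 * 4 ^ (l + 1) * (a * b) ^ (l + 2) ≠ 0 := by positivity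
  refine mul_left_cancel₀ hd ?_
  have e1 : 2 * 4 ^ (l + 1) * (a * b) ^ (l + 2) * (((4 * b) ^ (l + 1))⁻¹ *
      ((∑' n, cothTerm (l + 2) b n) / 2) - -e * ((4 * a) ^ (l + 1))⁻¹ *
      ((∑' n, cothTerm (l + 2) a n) / 2)) =
      a ^ (l + 2) * b * (∑' n, cothTerm (l + 2) b n) +
        e * (b ^ (l + 2) * a) * ∑' n, cothTerm (l + 2) a n := by
    field_simp
    ring
  rw [e1]
  -- Since e² = 1, multiplying by e moves the sign from the b-series to the a-series.
  linear_combination e * hr + (2 * 4 ^ (l + 1) * (a * b) ^ (l + 2) * R -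
    a ^ (l + 2) * b * (∑' n, cothTerm (l + 2) b n)) * hs

theorem corollary2p6 (k : ℕ) (hk : 1 < k) (α β : ℝ) (hαβ : α * β = Real.pi ^ 2) :
    -- convergence of all the series, and the reciprocity for the `coth` series
    (Summable (cothTerm k α) ∧ Summable (cothTerm k β) ∧
      (α : ℂ) * (β : ℂ) ^ k * ((∑' n : ℕ, cothTerm k α n : ℝ) : ℂ)
          + (-1) ^ k * (α : ℂ) ^ k * (β : ℂ) * ((∑' n : ℕ, cothTerm k β n : ℝ) : ℂ)
        = ((β : ℂ) ^ k + (-1) ^ k * (α : ℂ) ^ k) * riemannZeta (2 * (k : ℂ))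
          - 2 * ∑ p ∈ (Finset.HasAntidiagonal.antidiagonal k).filter (fun p => 1 ≤ p.1 ∧ 1 ≤ p.2),
              (-1) ^ p.2 * (α : ℂ) ^ p.2 * (β : ℂ) ^ p.1
                * riemannZeta (2 * (p.1 : ℂ)) * riemannZeta (2 * (p.2 : ℂ))) ∧
    -- the hyperbolic cotangent through the exponential
    (∀ x : ℝ, x ≠ 0 → coth x = 1 + 2 / (Real.exp (2 * x) - 1)) ∧
    -- Ramanujan's formula
    (Summable (expTerm k α) ∧ Summable (expTerm k β) ∧
      (4 * (β : ℂ)) ^ (-((k : ℤ) - 1))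
            * (riemannZeta (2 * (k : ℂ) - 1) / 2 + ((∑' n : ℕ, expTerm k β n : ℝ) : ℂ))
          - (-4 * (α : ℂ)) ^ (-((k : ℤ) - 1))
            * (riemannZeta (2 * (k : ℂ) - 1) / 2 + ((∑' n : ℕ, expTerm k α n : ℝ) : ℂ))
        = ∑ j ∈ Finset.range (k + 1),
            (-1 : ℂ) ^ ((j : ℤ) - 1)
              * (((bernoulli (2 * j) : ℚ) : ℂ) * ((bernoulli (2 * k - 2 * j) : ℚ) : ℂ)
                / (((2 * j).factorial : ℂ) * ((2 * k - 2 * j).factorial : ℂ)))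
              * (α : ℂ) ^ j * (β : ℂ) ^ (k - j)) := by
  obtain ⟨l, rfl⟩ := Nat.exists_eq_add_of_le' hk
  have hβα : β * α = Real.pi ^ 2 := mul_comm α β ▸ hαβ
  refine ⟨⟨(hasSum_cothTerm l hαβ).summable, (hasSum_cothTerm l hβα).summable, ?_⟩,
    fun x hx => coth_eq_one_add hx,
    (hasSum_expTerm l hαβ).summable, (hasSum_expTerm l hβα).summable, ?_⟩
  · simp only [riemannZeta_two_mul_eq_evenZeta]
    rw [sum_filter_antidiagonal_one_le]
    have hr := congrArg (fun x : ℝ => (x : ℂ)) (coth_reciprocity l hαβ)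
    have he : (-1 : ℂ) ^ (l + 2) = (-1) ^ l := by ring
    rw [he]
    simpa only [Complex.ofReal_add, Complex.ofReal_sub, Complex.ofReal_mul, Complex.ofReal_pow,
      Complex.ofReal_neg, Complex.ofReal_one, Complex.ofReal_sum, Complex.ofReal_ofNat] using hr
  · have hc : ∀ (s z : ℝ), (z : ℂ) / 2 + (((s - z) / 2 : ℝ) : ℂ) = ((s / 2 : ℝ) : ℂ) := by
      intro s z
      push_cast
      ring
    rw [(hasSum_expTerm l hαβ).tsum_eq, (hasSum_expTerm l hβα).tsum_eq, riemannZeta_odd, hc, hc,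
      show -(((l + 2 : ℕ) : ℤ) - 1) = -((l + 1 : ℕ) : ℤ) by push_cast; ring, zpow_neg, zpow_neg,
      zpow_natCast, zpow_natCast]
    have hr := congrArg (fun x : ℝ => (x : ℂ)) (ramanujan_formula l hαβ)
    push_cast at hr ⊢
    exact hr
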